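/- Let $\Bbbk$ be a field of characteristic zero. A \emph{generic Poisson algebra} over $\Bbbk$ is a commutative associative $\Bbbk$-algebra with identity, equipped with a $\Bbbk$-bilinear anti-commutative bracket $\{\cdot,\cdot\}$ satisfying the Leibniz identity $\{a,bc\}=\{a,b\}c+\{a,c\}b$ (the Jacobi identity is not required). For a set $Y$ let $\operatorname{GP}(Y)$ denote the free generic Poisson algebra over $\Bbbk$ generated by $Y$. An ideal of a generic Poisson algebra is an ideal for the product that is also closed under taking brackets with arbitrary elements of the algebra. \textbf{Theorem (Freiheitssatz for generic Poisson algebras).} Let $X$ be a set and $x\notin X$. Regard $\operatorname{GP}(X)$ as the subalgebra of $\operatorname{GP}(X\cup\{x\})$ generated by $X$. If $f\in \operatorname{GP}(X\cup\{x\})$ and $f\notin\operatorname{GP}(X)$, then the ideal $(f)$ of $\operatorname{GP}(X\cup\{x\})$ generated by $f$ satisfies $(f)\cap\operatorname{GP}(X)=\{0\}$. -/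

import Mathlib

/-- A generic Poisson algebra over `k`: a commutative associative unital `k`-algebra with a
`k`-bilinear anti-commutative bracket satisfying the Leibniz identity. No Jacobi identity. -/
class GPAlgebra (k : Type*) (A : Type*) [Field k] [CommRing A] [Algebra k A] where
  /-- the bracket `{a, b}` -/
  bracket : A →ₗ[k] A →ₗ[k] A
  bracket_self : ∀ a : A, bracket a a = 0
  leibniz : ∀ a b c : A, bracket a (b * c) = bracket a b * c + bracket a c * b

/-- Homomorphisms of generic Poisson algebras. -/
structure GPHom (k : Type*) (A B : Type*) [Field k] [CommRing A] [Algebra k A] [GPAlgebra k A]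
    [CommRing B] [Algebra k B] [GPAlgebra k B] extends A →ₐ[k] B where
  map_bracket : ∀ a b : A, toAlgHom (GPAlgebra.bracket (k := k) a b) =
    GPAlgebra.bracket (k := k) (toAlgHom a) (toAlgHom b)

/-- An ideal of a generic Poisson algebra: an ideal with respect to the product that is also
an ideal with respect to the (anti-commutative) bracket. -/
def IsGPIdeal (k : Type*) {A : Type*} [Field k] [CommRing A] [Algebra k A] [GPAlgebra k A]
    (I : Ideal A) : Prop :=
  ∀ a : A, ∀ b ∈ I, GPAlgebra.bracket (k := k) a b ∈ I

/-- The ideal `(f)` of a generic Poisson algebra generated by an element `f`. -/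
def gpIdealSpan (k : Type*) {A : Type*} [Field k] [CommRing A] [Algebra k A] [GPAlgebra k A]
    (f : A) : Ideal A :=
  sInf {I : Ideal A | IsGPIdeal k I ∧ f ∈ I}

theorem mem_gpIdealSpan_self (k : Type*) {A : Type*} [Field k] [CommRing A] [Algebra k A]
    [GPAlgebra k A] (f : A) : f ∈ gpIdealSpan k f :=
  Submodule.mem_sInf.2 fun _ hI => hI.2

theorem isGPIdeal_gpIdealSpan (k : Type*) {A : Type*} [Field k] [CommRing A] [Algebra k A]
    [GPAlgebra k A] (f : A) : IsGPIdeal k (gpIdealSpan k f) := fun a b hb =>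
  Submodule.mem_sInf.2 fun I hI => hI.1 a b (Submodule.mem_sInf.1 hb I hI)

namespace FreeGP

/-- Formal terms in the generators `X`, the scalars of `k` (the scalar `r` standing for `r • 1`)
and the operations of a generic Poisson algebra. -/
inductive Pre (k : Type*) (X : Type*)
  | of : X → Pre k X
  | scalar : k → Pre k X
  | add : Pre k X → Pre k X → Pre k X
  | mul : Pre k X → Pre k X → Pre k X
  | bracket : Pre k X → Pre k X → Pre k X

/-- The defining identities of generic Poisson `k`-algebras, closed under the operations. -/
inductive Rel (k : Type*) (X : Type*) [Field k] : Pre k X → Pre k X → Prop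
  | add_scalar {r s : k} : Rel k X (.scalar (r + s)) (.add (.scalar r) (.scalar s))
  | mul_scalar {r s : k} : Rel k X (.scalar (r * s)) (.mul (.scalar r) (.scalar s))
  | add_comm {a b : Pre k X} : Rel k X (.add a b) (.add b a)
  | add_assoc {a b c : Pre k X} : Rel k X (.add (.add a b) c) (.add a (.add b c))
  | zero_add {a : Pre k X} : Rel k X (.add (.scalar 0) a) a
  | mul_comm {a b : Pre k X} : Rel k X (.mul a b) (.mul b a)
  | mul_assoc {a b c : Pre k X} : Rel k X (.mul (.mul a b) c) (.mul a (.mul b c))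
  | one_mul {a : Pre k X} : Rel k X (.mul (.scalar 1) a) a
  | zero_mul {a : Pre k X} : Rel k X (.mul (.scalar 0) a) (.scalar 0)
  | left_distrib {a b c : Pre k X} :
      Rel k X (.mul a (.add b c)) (.add (.mul a b) (.mul a c))
  | bracket_add_left {a b c : Pre k X} :
      Rel k X (.bracket (.add a b) c) (.add (.bracket a c) (.bracket b c))
  | bracket_add_right {a b c : Pre k X} :
      Rel k X (.bracket a (.add b c)) (.add (.bracket a b) (.bracket a c))
  | bracket_smul_left {r : k} {a b : Pre k X} :
      Rel k X (.bracket (.mul (.scalar r) a) b) (.mul (.scalar r) (.bracket a b))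
  | bracket_smul_right {r : k} {a b : Pre k X} :
      Rel k X (.bracket a (.mul (.scalar r) b)) (.mul (.scalar r) (.bracket a b))
  | bracket_self {a : Pre k X} : Rel k X (.bracket a a) (.scalar 0)
  | leibniz {a b c : Pre k X} : Rel k X (.bracket a (.mul b c))
      (.add (.mul (.bracket a b) c) (.mul (.bracket a c) b))
  | add_congr_left {a b c : Pre k X} : Rel k X a b → Rel k X (.add a c) (.add b c)
  | add_congr_right {a b c : Pre k X} : Rel k X a b → Rel k X (.add c a) (.add c b)
  | mul_congr_left {a b c : Pre k X} : Rel k X a b → Rel k X (.mul a c) (.mul b c)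
  | mul_congr_right {a b c : Pre k X} : Rel k X a b → Rel k X (.mul c a) (.mul c b)
  | bracket_congr_left {a b c : Pre k X} : Rel k X a b → Rel k X (.bracket a c) (.bracket b c)
  | bracket_congr_right {a b c : Pre k X} : Rel k X a b → Rel k X (.bracket c a) (.bracket c b)

end FreeGP

/-- The free generic Poisson algebra `GP(X)` over `k` on the set of generators `X`. -/
def FreeGP (k : Type*) (X : Type*) [Field k] : Type _ := Quot (FreeGP.Rel k X)

namespace FreeGP

/-- The class of a term. -/
def mk (k : Type*) {X : Type*} [Field k] (a : Pre k X) : FreeGP k X := Quot.mk _ a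

instance instAdd (k : Type*) (X : Type*) [Field k] : Add (FreeGP k X) where
  add := Quot.map₂ Pre.add (fun _ _ _ => Rel.add_congr_right) fun _ _ _ => Rel.add_congr_left

instance instMul (k : Type*) (X : Type*) [Field k] : Mul (FreeGP k X) where
  mul := Quot.map₂ Pre.mul (fun _ _ _ => Rel.mul_congr_right) fun _ _ _ => Rel.mul_congr_left

instance instZero (k : Type*) (X : Type*) [Field k] : Zero (FreeGP k X) where
  zero := mk k (.scalar 0)

instance instOne (k : Type*) (X : Type*) [Field k] : One (FreeGP k X) where
  one := mk k (.scalar 1)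

instance instNeg (k : Type*) (X : Type*) [Field k] : Neg (FreeGP k X) where
  neg := Quot.map (Pre.mul (.scalar (-1))) fun _ _ => Rel.mul_congr_right

instance instCommRing (k : Type*) (X : Type*) [Field k] : CommRing (FreeGP k X) where
  nsmul := nsmulRec
  zsmul := zsmulRec
  add_assoc := by rintro ⟨a⟩ ⟨b⟩ ⟨c⟩; exact Quot.sound Rel.add_assoc
  add_comm := by rintro ⟨a⟩ ⟨b⟩; exact Quot.sound Rel.add_comm
  zero_add := by rintro ⟨a⟩; exact Quot.sound Rel.zero_add
  add_zero := by
    rintro ⟨a⟩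
    exact (Quot.sound Rel.add_comm).trans (Quot.sound Rel.zero_add)
  mul_assoc := by rintro ⟨a⟩ ⟨b⟩ ⟨c⟩; exact Quot.sound Rel.mul_assoc
  mul_comm := by rintro ⟨a⟩ ⟨b⟩; exact Quot.sound Rel.mul_comm
  one_mul := by rintro ⟨a⟩; exact Quot.sound Rel.one_mul
  mul_one := by
    rintro ⟨a⟩
    exact (Quot.sound Rel.mul_comm).trans (Quot.sound Rel.one_mul)
  zero_mul := by rintro ⟨a⟩; exact Quot.sound Rel.zero_mul
  mul_zero := by
    rintro ⟨a⟩
    exact (Quot.sound Rel.mul_comm).trans (Quot.sound Rel.zero_mul)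
  left_distrib := by rintro ⟨a⟩ ⟨b⟩ ⟨c⟩; exact Quot.sound Rel.left_distrib
  right_distrib := by
    rintro ⟨a⟩ ⟨b⟩ ⟨c⟩
    exact (Quot.sound Rel.mul_comm).trans ((Quot.sound Rel.left_distrib).trans
      ((Quot.sound (Rel.add_congr_left Rel.mul_comm)).trans
        (Quot.sound (Rel.add_congr_right Rel.mul_comm))))
  neg_add_cancel := by
    rintro ⟨a⟩
    have h1 : Quot.mk (Rel k X) (.add (.mul (.scalar (-1)) a) a) =
        Quot.mk (Rel k X) (.add (.mul a (.scalar (-1))) (.mul a (.scalar 1))) :=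
      (Quot.sound (Rel.add_congr_left Rel.mul_comm)).trans
        ((Quot.sound (Rel.add_congr_right Rel.one_mul)).symm.trans
          (Quot.sound (Rel.add_congr_right Rel.mul_comm)))
    have h2 : Quot.mk (Rel k X) (.add (.mul a (.scalar (-1))) (.mul a (.scalar 1))) =
        Quot.mk (Rel k X) (.mul a (.scalar (-1 + 1))) :=
      (Quot.sound Rel.left_distrib).symm.trans
        (Quot.sound (Rel.mul_congr_right Rel.add_scalar)).symm
    refine h1.trans (h2.trans ?_)
    rw [neg_add_cancel]
    exact (Quot.sound Rel.mul_comm).trans (Quot.sound Rel.zero_mul)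

instance instAlgebra (k : Type*) (X : Type*) [Field k] :
    Algebra k (FreeGP k X) :=
  RingHom.toAlgebra
    { toFun := fun r => mk k (.scalar r)
      map_one' := rfl
      map_zero' := rfl
      map_mul' := fun _ _ => Quot.sound Rel.mul_scalar
      map_add' := fun _ _ => Quot.sound Rel.add_scalar }

instance instGPAlgebra (k : Type*) (X : Type*) [Field k] :
    GPAlgebra k (FreeGP k X) where
  bracket := LinearMap.mk₂ k
    (Quot.map₂ Pre.bracket (fun _ _ _ => Rel.bracket_congr_right)
      fun _ _ _ => Rel.bracket_congr_left)
    (by rintro ⟨a⟩ ⟨b⟩ ⟨c⟩; exact Quot.sound Rel.bracket_add_left)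
    (by
      rintro r ⟨a⟩ ⟨b⟩
      exact Quot.sound Rel.bracket_smul_left)
    (by rintro ⟨a⟩ ⟨b⟩ ⟨c⟩; exact Quot.sound Rel.bracket_add_right)
    (by
      rintro r ⟨a⟩ ⟨b⟩
      exact Quot.sound Rel.bracket_smul_right)
  bracket_self := by rintro ⟨a⟩; exact Quot.sound Rel.bracket_self
  leibniz := by rintro ⟨a⟩ ⟨b⟩ ⟨c⟩; exact Quot.sound Rel.leibniz

/-- The generators of the free generic Poisson algebra. -/
def of (k : Type*) {X : Type*} [Field k] (x : X) : FreeGP k X := mk k (.of x)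

/-- Evaluation of terms in a generic Poisson algebra. -/
def Pre.eval {k X A : Type*} [Field k] [CommRing A] [Algebra k A] [GPAlgebra k A] (φ : X → A) :
    Pre k X → A
  | .of x => φ x
  | .scalar r => algebraMap k A r
  | .add a b => Pre.eval φ a + Pre.eval φ b
  | .mul a b => Pre.eval φ a * Pre.eval φ b
  | .bracket a b => GPAlgebra.bracket (k := k) (Pre.eval φ a) (Pre.eval φ b)

theorem Pre.eval_eq_of_rel {k X A : Type*} [Field k] [CommRing A] [Algebra k A] [GPAlgebra k A]
    (φ : X → A) {a b : Pre k X} (h : Rel k X a b) : Pre.eval φ a = Pre.eval φ b := by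
  induction h with
  | add_scalar => simp [Pre.eval]
  | mul_scalar => simp [Pre.eval]
  | add_comm => simp only [Pre.eval]; ring
  | add_assoc => simp only [Pre.eval]; ring
  | zero_add => simp [Pre.eval]
  | mul_comm => simp only [Pre.eval]; ring
  | mul_assoc => simp only [Pre.eval]; ring
  | one_mul => simp [Pre.eval]
  | zero_mul => simp [Pre.eval]
  | left_distrib => simp only [Pre.eval]; ring
  | bracket_add_left => simp [Pre.eval]
  | bracket_add_right => simp [Pre.eval]
  | bracket_smul_left => simp [Pre.eval, ← Algebra.smul_def]
  | bracket_smul_right => simp [Pre.eval, ← Algebra.smul_def]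
  | bracket_self => simp [Pre.eval, GPAlgebra.bracket_self]
  | leibniz => simp [Pre.eval, GPAlgebra.leibniz]
  | add_congr_left _ ih => simp only [Pre.eval, ih]
  | add_congr_right _ ih => simp only [Pre.eval, ih]
  | mul_congr_left _ ih => simp only [Pre.eval, ih]
  | mul_congr_right _ ih => simp only [Pre.eval, ih]
  | bracket_congr_left _ ih => simp only [Pre.eval, ih]
  | bracket_congr_right _ ih => simp only [Pre.eval, ih]

/-- The homomorphism from the free generic Poisson algebra determined by the images of the
generators. -/
def lift {k X A : Type*} [Field k] [CommRing A] [Algebra k A] [GPAlgebra k A] (φ : X → A) :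
    GPHom k (FreeGP k X) A where
  toFun := Quot.lift (Pre.eval φ) fun _ _ h => Pre.eval_eq_of_rel φ h
  map_one' := map_one (algebraMap k A)
  map_zero' := map_zero (algebraMap k A)
  map_mul' := by rintro ⟨a⟩ ⟨b⟩; rfl
  map_add' := by rintro ⟨a⟩ ⟨b⟩; rfl
  commutes' := fun _ => rfl
  map_bracket := by rintro ⟨a⟩ ⟨b⟩; rfl

theorem lift_of {k X A : Type*} [Field k] [CommRing A] [Algebra k A] [GPAlgebra k A] (φ : X → A)
    (x : X) : (lift φ : GPHom k (FreeGP k X) A).toAlgHom (of k x) = φ x := rfl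

/-- Uniqueness in the universal property of the free generic Poisson algebra. -/
theorem hom_ext {k X A : Type*} [Field k] [CommRing A] [Algebra k A] [GPAlgebra k A]
    (F G : GPHom k (FreeGP k X) A)
    (h : ∀ x : X, F.toAlgHom (of k x) = G.toAlgHom (of k x)) (a : FreeGP k X) :
    F.toAlgHom a = G.toAlgHom a := by
  obtain ⟨a⟩ := a
  induction a with
  | of x => exact h x
  | scalar r => exact (F.toAlgHom.commutes r).trans (G.toAlgHom.commutes r).symm
  | add a b iha ihb =>
    exact (map_add F.toAlgHom (mk k a) (mk k b)).trans
      ((congrArg₂ (· + ·) iha ihb).trans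
        (map_add G.toAlgHom (mk k a) (mk k b)).symm)
  | mul a b iha ihb =>
    exact (map_mul F.toAlgHom (mk k a) (mk k b)).trans
      ((congrArg₂ (· * ·) iha ihb).trans
        (map_mul G.toAlgHom (mk k a) (mk k b)).symm)
  | bracket a b iha ihb =>
    exact (F.map_bracket (mk k a) (mk k b)).trans
      ((congrArg₂ (fun u v => GPAlgebra.bracket (k := k) u v) iha ihb).trans
        (G.map_bracket (mk k a) (mk k b)).symm)

/-- The canonical homomorphism `GP(X) → GP(X ∪ {x})`, where `X ∪ {x}` is `Option X` and the new
generator `x` is `none`. -/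
def inclusion (k : Type*) (X : Type*) [Field k] : GPHom k (FreeGP k X) (FreeGP k (Option X)) :=
  lift fun y => of k (some y)

theorem inclusion_injective (k : Type*) (X : Type*) [Field k] :
    Function.Injective (inclusion k X).toAlgHom := by
  let r : GPHom k (FreeGP k (Option X)) (FreeGP k X) := lift fun o => o.elim 0 (of k)
  let c : GPHom k (FreeGP k X) (FreeGP k X) :=
    { r.toAlgHom.comp (inclusion k X).toAlgHom with
      map_bracket := fun a b =>
        (congrArg r.toAlgHom ((inclusion k X).map_bracket a b)).trans (r.map_bracket _ _) }
  let e : GPHom k (FreeGP k X) (FreeGP k X) :=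
    { AlgHom.id k (FreeGP k X) with map_bracket := fun _ _ => rfl }
  exact Function.LeftInverse.injective (g := r.toAlgHom) (hom_ext c e fun _ => rfl)

/-- The subalgebra `GP(X)` of `GP(X ∪ {x})`. -/
def baseSubalgebra (k : Type*) (X : Type*) [Field k] : Subalgebra k (FreeGP k (Option X)) :=
  (inclusion k X).toAlgHom.range

end FreeGP

/-! Choose one representative of each iterated bracket up to sign (a normal tree).
Anti-commutativity and the Leibniz rule make every element a polynomial in normal trees. If f is not
in GP(X), its polynomial p involves a tree containing x; let u be a longest such tree. Let R be the
polynomial ring in all normal trees except u, and K an algebraic closure of its fraction field. Then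
p, read as a polynomial in u over R, has a root α in K.

A bracket on K can be prescribed freely on pairs of variables of R, because K is formally étale over
R in characteristic zero. Setting {s, t} to be the variable st, or α when st = u, yields a
homomorphism φ to K that sends each normal tree to its variable and u to α, as long as the tree does
not contain u properly. By maximality of u this covers all trees in p, so φ(f) = 0. It also covers
all trees over X, which go to independent variables. So φ kills (f) and is injective on GP(X).

Only generation by normal trees is used, not their algebraic independence. -/

/-! ### Brackets on formally étale extensions of polynomial rings -/

open MvPolynomial in
/-- A biderivation on a formally étale extension of a polynomial algebra can be prescribed
arbitrarily on pairs of variables, subject only to anti-commutativity. -/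
theorem GPAlgebra.exists_bracket_of_formallyEtale {k σ K : Type*} [Field k] [CharZero k] [Field K]
    [Algebra k K] [Algebra (MvPolynomial σ k) K] [IsScalarTower k (MvPolynomial σ k) K]
    [Algebra.FormallyEtale (MvPolynomial σ k) K] (c : σ → σ → K) (hc : ∀ i j, c i j = -c j i) :
    ∃ I : GPAlgebra k K, ∀ i j, I.bracket (algebraMap (MvPolynomial σ k) K (X i))
      (algebraMap (MvPolynomial σ k) K (X j)) = c i j := by
  have : CharZero K := charZero_of_injective_algebraMap (algebraMap k K).injective
  -- Étaleness identifies the differentials of `K` with the base change of those of the polynomial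
  -- ring, so the `dX i` form a `K`-basis and a bilinear form on them can be chosen freely.
  let e := KaehlerDifferential.tensorKaehlerEquivOfFormallyEtale k (MvPolynomial σ k) K
  let b := ((KaehlerDifferential.mvPolynomialBasis k σ).baseChange K).map e
  have hb : ∀ i, b i = KaehlerDifferential.D k K (algebraMap (MvPolynomial σ k) K (X i)) := by
    intro i
    simp [b, e, KaehlerDifferential.mvPolynomialBasis_apply]
  let β := b.constr K fun i => b.constr K (c i)
  have hβ : ∀ i j, β (b i) (b j) = c i j := fun i j => by simp [β]
  have hskew : β = -β.flip := b.ext fun i => b.ext fun j => by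
    simp only [LinearMap.neg_apply, LinearMap.flip_apply, hβ, ← hc]
  -- Skew-symmetry gives `β w w = -β w w`; characteristic zero then makes it vanish.
  have hself : ∀ w, β w w = 0 := fun w => by
    have h := congrArg (fun γ => γ w w) hskew
    simpa only [LinearMap.neg_apply, LinearMap.flip_apply, self_eq_neg] using h
  refine ⟨{
    bracket := LinearMap.mk₂ k
      (fun x y => β (KaehlerDifferential.D k K x) (KaehlerDifferential.D k K y))
      (by simp) (fun r x y => ?_) (by simp) (fun r x y => ?_)
    bracket_self := fun a => hself _
    leibniz := fun x y z => ?_ }, fun i j => ?_⟩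
  · rw [Derivation.map_smul, ← algebraMap_smul K r, map_smul, LinearMap.smul_apply, algebraMap_smul]
  · rw [Derivation.map_smul, ← algebraMap_smul K r, map_smul, algebraMap_smul]
  · simp only [LinearMap.mk₂_apply, Derivation.leibniz, map_add, map_smul, smul_eq_mul]
    ring
  · simp only [LinearMap.mk₂_apply, ← hb, hβ]

/-! ### Subalgebras closed under the bracket -/

namespace GPAlgebra

variable {k A : Type*} [Field k] [CommRing A] [Algebra k A] [GPAlgebra k A]

theorem bracket_skew (a b : A) : bracket (k := k) a b = -bracket (k := k) b a :=
  (LinearMap.IsAlt.neg (B := bracket (k := k) (A := A)) bracket_self b a).symm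

theorem bracket_algebraMap_right (a : A) (r : k) : bracket (k := k) a (algebraMap k A r) = 0 := by
  -- Leibniz on `1 * 1` reads `{a, 1} = {a, 1} + {a, 1}`.
  have h := leibniz (k := k) a 1 1
  simp only [mul_one, left_eq_add] at h
  rw [Algebra.algebraMap_eq_smul_one, map_smul, h, smul_zero]

theorem bracket_mem_adjoin_of_right {s : Set A} {a : A}
    (h : ∀ b ∈ s, bracket (k := k) a b ∈ Algebra.adjoin k s) {b : A}
    (hb : b ∈ Algebra.adjoin k s) : bracket (k := k) a b ∈ Algebra.adjoin k s := by
  induction hb using Algebra.adjoin_induction with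
  | mem b hb => exact h b hb
  | algebraMap r => rw [bracket_algebraMap_right]; exact zero_mem _
  | add b c _ _ ihb ihc => rw [map_add]; exact add_mem ihb ihc
  | mul b c hb hc ihb ihc =>
    rw [leibniz]
    exact add_mem (mul_mem ihb hc) (mul_mem ihc hb)

/-- A subalgebra is closed under the bracket if its generators have brackets in it. -/
theorem bracket_mem_adjoin {s : Set A}
    (h : ∀ a ∈ s, ∀ b ∈ s, bracket (k := k) a b ∈ Algebra.adjoin k s) {a b : A}
    (ha : a ∈ Algebra.adjoin k s) (hb : b ∈ Algebra.adjoin k s) :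
    bracket (k := k) a b ∈ Algebra.adjoin k s := by
  refine bracket_mem_adjoin_of_right (fun b hb => ?_) hb
  rw [bracket_skew]
  exact neg_mem (bracket_mem_adjoin_of_right (h b hb) ha)

end GPAlgebra

/-! ### Generation by normal trees -/

namespace FreeGP

/-- A tree is normal if the left factor is smaller than the right one at every inner node. -/
def IsNormal {Y : Type*} [LinearOrder (FreeMagma Y)] : FreeMagma Y → Prop
  | .of _ => True
  | .mul a b => IsNormal a ∧ IsNormal b ∧ a < b

/-- The iterated bracket of generators described by a tree. -/
def treeBracket (k : Type*) {Y : Type*} [Field k] : FreeMagma Y → FreeGP k Y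
  | .of y => of k y
  | .mul a b => GPAlgebra.bracket (k := k) (treeBracket k a) (treeBracket k b)

/-- The trees all of whose leaves are old generators. -/
def IsBase {X : Type*} : FreeMagma (Option X) → Prop
  | .of y => y.isSome
  | .mul a b => IsBase a ∧ IsBase b

/-- The values of normal trees with a given property. -/
def normalValues (k : Type*) {Y : Type*} [Field k] [LinearOrder (FreeMagma Y)]
    (P : FreeMagma Y → Prop) : Set (FreeGP k Y) :=
  treeBracket k '' {t | IsNormal t ∧ P t}

/-- By trichotomy, the bracket of two normal trees is zero or, up to sign, again a normal tree; the
Leibniz rule extends closure to polynomials in them. -/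
theorem bracket_mem_adjoin_normalValues {k Y : Type*} [Field k] [LinearOrder (FreeMagma Y)]
    {P : FreeMagma Y → Prop} (hP : ∀ a b, P a → P b → P (a.mul b)) {a b : FreeGP k Y}
    (ha : a ∈ Algebra.adjoin k (normalValues k P)) (hb : b ∈ Algebra.adjoin k (normalValues k P)) :
    GPAlgebra.bracket (k := k) a b ∈ Algebra.adjoin k (normalValues k P) := by
  refine GPAlgebra.bracket_mem_adjoin ?_ ha hb
  rintro _ ⟨s, ⟨hs, hs'⟩, rfl⟩ _ ⟨t, ⟨ht, ht'⟩, rfl⟩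
  rcases lt_trichotomy s t with h | rfl | h
  · exact Algebra.subset_adjoin ⟨s.mul t, ⟨⟨hs, ht, h⟩, hP _ _ hs' ht'⟩, rfl⟩
  · rw [GPAlgebra.bracket_self]
    exact zero_mem _
  · rw [GPAlgebra.bracket_skew]
    exact neg_mem (Algebra.subset_adjoin ⟨t.mul s, ⟨⟨ht, hs, h⟩, hP _ _ ht' hs'⟩, rfl⟩)

/-- Serves twice: with `P` always true for the whole algebra, and with `P := IsBase` for the image
of GP(X). -/
theorem lift_mem_adjoin_normalValues {k Y Z : Type*} [Field k] [LinearOrder (FreeMagma Y)]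
    {P : FreeMagma Y → Prop} (hP : ∀ a b, P a → P b → P (a.mul b)) (φ : Z → Y)
    (hφ : ∀ z, P (.of (φ z))) (g : FreeGP k Z) :
    (lift fun z => of k (φ z) : GPHom k (FreeGP k Z) (FreeGP k Y)).toAlgHom g ∈
      Algebra.adjoin k (normalValues k P) := by
  obtain ⟨g⟩ := g
  change Pre.eval (fun z => of k (φ z)) g ∈ _
  induction g with
  | of z => exact Algebra.subset_adjoin ⟨.of (φ z), ⟨trivial, hφ z⟩, rfl⟩
  | scalar r => exact Subalgebra.algebraMap_mem _ r
  | add a b iha ihb => exact add_mem iha ihb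
  | mul a b iha ihb => exact mul_mem iha ihb
  | bracket a b iha ihb => exact bracket_mem_adjoin_normalValues hP iha ihb

theorem mem_adjoin_normalValues {k Y : Type*} [Field k] [LinearOrder (FreeMagma Y)]
    (g : FreeGP k Y) : g ∈ Algebra.adjoin k (normalValues k fun _ => True) := by
  have h := lift_mem_adjoin_normalValues (k := k) (P := fun _ : FreeMagma Y => True)
    (fun _ _ _ _ => trivial) id (fun _ => trivial) g
  rwa [hom_ext (lift fun z => of k (id z)) { AlgHom.id k _ with map_bracket := fun _ _ => rfl }
    (fun _ => rfl) g] at h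

/-- The values of polynomials in normal trees. -/
noncomputable def ofNormal (k : Type*) (Y : Type*) [Field k] [LinearOrder (FreeMagma Y)] :
    MvPolynomial {t : FreeMagma Y // IsNormal t} k →ₐ[k] FreeGP k Y :=
  MvPolynomial.aeval fun t => treeBracket k t.1

theorem exists_ofNormal_eq {k Y : Type*} [Field k] [LinearOrder (FreeMagma Y)]
    {P : FreeMagma Y → Prop} {g : FreeGP k Y} (hg : g ∈ Algebra.adjoin k (normalValues k P)) :
    ∃ q, ofNormal k Y q = g ∧ ∀ t ∈ q.vars, P t.1 := by
  have hset : normalValues k P =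
      Set.range fun t : {t : {t : FreeMagma Y // IsNormal t} // P t.1} => treeBracket k t.1.1 := by
    ext x
    constructor
    · rintro ⟨t, ⟨h1, h2⟩, rfl⟩
      exact ⟨⟨⟨t, h1⟩, h2⟩, rfl⟩
    · rintro ⟨t, rfl⟩
      exact ⟨t.1.1, ⟨t.1.2, t.2⟩, rfl⟩
  rw [hset, Algebra.adjoin_range_eq_range_aeval] at hg
  obtain ⟨q, rfl⟩ := hg
  refine ⟨MvPolynomial.rename Subtype.val q, ?_, fun t ht => ?_⟩
  · simp [ofNormal, MvPolynomial.aeval_rename, Function.comp_def]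
  · classical
    obtain ⟨s, -, rfl⟩ := Finset.mem_image.1 (MvPolynomial.vars_rename _ _ ht)
    exact s.2

theorem treeBracket_mem_baseSubalgebra {k X : Type*} [Field k] (t : FreeMagma (Option X))
    (ht : IsBase t) : treeBracket k t ∈ baseSubalgebra k X := by
  induction t with
  | ih1 y =>
    obtain ⟨x, rfl⟩ := Option.isSome_iff_exists.1 ht
    exact ⟨of k x, rfl⟩
  | ih2 a b iha ihb =>
    obtain ⟨a', ha⟩ := iha ht.1
    obtain ⟨b', hb⟩ := ihb ht.2
    refine ⟨GPAlgebra.bracket (k := k) a' b', ((inclusion k X).map_bracket a' b').trans ?_⟩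
    exact congrArg₂ (fun u v => GPAlgebra.bracket (k := k) u v) ha hb

theorem ofNormal_mem_baseSubalgebra {k X : Type*} [Field k] [LinearOrder (FreeMagma (Option X))]
    (p : MvPolynomial {t : FreeMagma (Option X) // IsNormal t} k)
    (hp : ∀ t ∈ p.vars, IsBase t.1) : ofNormal k (Option X) p ∈ baseSubalgebra k X := by
  rw [p.as_sum, map_sum]
  refine sum_mem fun d hd => ?_
  rw [ofNormal, MvPolynomial.aeval_monomial]
  refine mul_mem (Subalgebra.algebraMap_mem _ _) (prod_mem fun t ht => pow_mem ?_ _)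
  exact treeBracket_mem_baseSubalgebra _ (hp t ((MvPolynomial.mem_vars_iff_mem_support t).2 ⟨d, hd, ht⟩))

/-! ### Specialisation to a field with a bracket -/

open MvPolynomial in
/-- A polynomial involving the variable `u` vanishes at a suitable point of an algebraic extension
of the field of rational functions in the other variables. -/
theorem exists_aeval_eq_zero {k σ K : Type*} [Field k] [Field K] [IsAlgClosed K] [Algebra k K]
    (u : σ) [Algebra (MvPolynomial {t // t ≠ u} k) K]
    [IsScalarTower k (MvPolynomial {t // t ≠ u} k) K]
    (hinj : Function.Injective (algebraMap (MvPolynomial {t // t ≠ u} k) K))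
    (p : MvPolynomial σ k) (hu : u ∈ p.vars) :
    ∃ v : σ → K, (∀ t (h : t ≠ u), v t = algebraMap (MvPolynomial {t // t ≠ u} k) K (X ⟨t, h⟩)) ∧
      aeval v p = 0 := by
  let := Classical.decEq σ
  let P := optionEquivLeft k {t // t ≠ u} (rename (Equiv.optionSubtypeNe u).symm p)
  -- Since `u` occurs in `p`, the degree in `u` is nonzero, and injectivity into `K` preserves it;
  -- hence a root `α` exists.
  have hdeg : (P.map (algebraMap _ K)).degree ≠ 0 := by
    rw [Polynomial.degree_map_eq_of_injective hinj]
    intro h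
    have h' := degreeOf_eq_natDegree u p
    rw [Polynomial.natDegree_eq_of_degree_eq_some h] at h'
    exact mem_vars_iff_degreeOf_ne_zero.1 hu h'
  obtain ⟨α, hα⟩ := IsAlgClosed.exists_root _ hdeg
  let v : σ → K := fun t =>
    if h : t = u then α else algebraMap (MvPolynomial {t // t ≠ u} k) K (X ⟨t, h⟩)
  refine ⟨v, fun t h => dif_neg h, ?_⟩
  have hv : (((Polynomial.aeval (R := MvPolynomial {t // t ≠ u} k) α).restrictScalars k).comp
      (optionEquivLeft k {t // t ≠ u}).toAlgHom).comp
        (rename (Equiv.optionSubtypeNe u).symm) = aeval v := by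
    ext t
    by_cases h : t = u
    · subst h
      simp [v, optionEquivLeft_X_none]
    · simp [v, h, Equiv.optionSubtypeNe_symm_of_ne h]
  rw [← hv]
  rw [Polynomial.IsRoot, Polynomial.eval_map_algebraMap] at hα
  exact hα

universe u v

open MvPolynomial in
/-- There is a homomorphism to a field that kills a given polynomial in normal trees involving
the tree `u` but no tree containing `u` properly, and that is injective on the polynomials
in normal trees not containing `u`. -/
theorem exists_hom_ofNormal_eq_zero {k : Type u} {Y : Type v} [Field k] [CharZero k]
    [LinearOrder (FreeMagma Y)] (u : {t : FreeMagma Y // IsNormal t})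
    (Q : FreeMagma Y → Prop) (hQ : ∀ a b, Q (.mul a b) → (Q a ∧ a ≠ u) ∧ Q b ∧ b ≠ u)
    (p : MvPolynomial {t : FreeMagma Y // IsNormal t} k) (hu : u ∈ p.vars)
    (hp : ∀ t ∈ p.vars, Q t.1) :
    ∃ (K : Type (max u v)) (_ : Field K) (_ : Algebra k K) (_ : GPAlgebra k K)
      (φ : GPHom k (FreeGP k Y) K), φ.toAlgHom (ofNormal k Y p) = 0 ∧
        ∀ q : MvPolynomial {t : FreeMagma Y // IsNormal t} k,
          (∀ t ∈ q.vars, Q t.1 ∧ t ≠ u) → φ.toAlgHom (ofNormal k Y q) = 0 → q = 0 := by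
  classical
  let R := MvPolynomial {t : {t : FreeMagma Y // IsNormal t} // t ≠ u} k
  let K := AlgebraicClosure (FractionRing R)
  have : CharZero (FractionRing R) :=
    charZero_of_injective_algebraMap (algebraMap k (FractionRing R)).injective
  have : Algebra.FormallyEtale R (FractionRing R) :=
    .of_isLocalization (nonZeroDivisors R)
  have : Algebra.FormallyEtale (FractionRing R) K := .of_isSeparable _ _
  have : Algebra.FormallyEtale R K := .comp R (FractionRing R) K
  have hinj : Function.Injective (algebraMap R K) := by
    rw [IsScalarTower.algebraMap_eq R (FractionRing R) K]
    exact (algebraMap (FractionRing R) K).injective.comp (IsFractionRing.injective R _)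
  obtain ⟨v, hv, hvp⟩ := exists_aeval_eq_zero (K := K) u hinj p hu
  -- The default `0` is harmless: below, `w` only matters at products of normal trees in increasing
  -- order, which are normal.
  let w : FreeMagma Y → K := fun t => if h : IsNormal t then v ⟨t, h⟩ else 0
  have hw : ∀ t : {t : FreeMagma Y // IsNormal t}, w t.1 = v t := fun t => dif_pos t.2
  -- The bracket of two variables is the value of the product tree, with the sign of the ordering.
  -- If that tree is `u`, the value is the root of `p`.
  let c : FreeMagma Y → FreeMagma Y → K := fun s t =>
    if s < t then w (.mul s t) else if t < s then -w (.mul t s) else 0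
  have hc : ∀ s t, c s t = -c t s := fun s t => by
    rcases lt_trichotomy s t with h | rfl | h
    · simp only [c, if_pos h, if_neg h.not_gt]
      exact (neg_neg _).symm
    · simp [c]
    · simp only [c, if_pos h, if_neg h.not_gt]
  obtain ⟨I, hI⟩ := GPAlgebra.exists_bracket_of_formallyEtale (k := k) (K := K)
    (fun s t : {t : {t : FreeMagma Y // IsNormal t} // t ≠ u} => c s.1.1 t.1.1)
    (fun s t => hc _ _)
  let φ : GPHom k (FreeGP k Y) K := lift fun y => v ⟨.of y, trivial⟩
  -- Brackets are prescribed only between variables other than `u`. The condition `Q` keeps `u` from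
  -- being a factor, so the induction never has to bracket with the root.
  have hφ : ∀ t (ht : IsNormal t), Q t → φ.toAlgHom (treeBracket k t) = v ⟨t, ht⟩ := by
    intro t
    induction t with
    | ih1 y => intro _ _; rfl
    | ih2 a b iha ihb =>
      intro ht hQt
      obtain ⟨⟨hQa, hau⟩, hQb, hbu⟩ := hQ a b hQt
      obtain ⟨ha, hb, hab⟩ := id ht
      have hau' : (⟨a, ha⟩ : {t // IsNormal t}) ≠ u := fun h => hau (congrArg Subtype.val h)
      have hbu' : (⟨b, hb⟩ : {t // IsNormal t}) ≠ u := fun h => hbu (congrArg Subtype.val h)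
      refine (φ.map_bracket (treeBracket k a) (treeBracket k b)).trans ?_
      rw [iha ha hQa, ihb hb hQb, hv _ hau', hv _ hbu']
      refine (hI ⟨_, hau'⟩ ⟨_, hbu'⟩).trans ?_
      exact (if_pos hab).trans (hw ⟨_, ht⟩)
  have hφq : ∀ q : MvPolynomial {t : FreeMagma Y // IsNormal t} k, (∀ t ∈ q.vars, Q t.1) →
      φ.toAlgHom (ofNormal k Y q) = aeval v q := by
    intro q hq
    rw [ofNormal, ← AlgHom.comp_apply, comp_aeval]
    exact eval₂Hom_congr' rfl (fun t ht _ => hφ t.1 t.2 (hq t ht)) rfl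
  refine ⟨K, inferInstance, inferInstance, I, φ, (hφq p hp).trans hvp, fun q hq hq0 => ?_⟩
  rw [hφq q fun t ht => (hq t ht).1] at hq0
  -- Without `u`, the polynomial lies in `R`, and evaluation at `v` is the embedding of `R` in `K`.
  obtain ⟨q', rfl⟩ := exists_rename_eq_of_vars_subset_range q
    (Subtype.val : {t : {t : FreeMagma Y // IsNormal t} // t ≠ u} → _) Subtype.val_injective
    (fun t ht => ⟨⟨t, (hq t ht).2⟩, rfl⟩)
  have hq' : aeval v (rename Subtype.val q') = algebraMap R K q' := by
    rw [aeval_rename]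
    have : aeval (v ∘ Subtype.val) = IsScalarTower.toAlgHom k R K := by
      ext t
      exact (aeval_X _ _).trans (hv t.1 t.2)
    rw [this]
    rfl
  rw [hq', map_eq_zero_iff _ hinj] at hq0
  rw [hq0, map_zero]

/-! ### The Freiheitssatz -/

theorem gpIdealSpan_inter_baseSubalgebra {k : Type*} [Field k] [CharZero k] {X : Type*}
    (f : FreeGP k (Option X)) (hf : f ∉ baseSubalgebra k X) :
    (gpIdealSpan k f : Set (FreeGP k (Option X))) ∩
      (baseSubalgebra k X : Set (FreeGP k (Option X))) = {0} := by
  classical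
  -- Any linear order would do; no compatibility with length or products is needed.
  let : LinearOrder (FreeMagma (Option X)) := linearOrderOfSTO WellOrderingRel
  obtain ⟨p, rfl, -⟩ := exists_ofNormal_eq (mem_adjoin_normalValues f)
  have hne : (p.vars.filter fun t => ¬IsBase t.1).Nonempty := by
    by_contra h
    rw [Finset.not_nonempty_iff_eq_empty, Finset.filter_eq_empty_iff] at h
    exact hf (ofNormal_mem_baseSubalgebra p fun t ht => not_not.1 (h ht))
  obtain ⟨u, hu, hmax⟩ := Finset.exists_max_image _ (fun t => t.1.length) hne
  rw [Finset.mem_filter] at hu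
  -- Base trees of any length are admitted since they cannot contain the non-base tree `u`; other
  -- trees are bounded by the length of `u`, so they cannot contain it properly.
  obtain ⟨K, _, _, _, φ, hφ, hinj⟩ := exists_hom_ofNormal_eq_zero u
    (fun t => IsBase t ∨ t.length ≤ u.1.length) (fun a b hab => by
      have key : ∀ c : FreeMagma (Option X), IsBase c ∨ c.length < u.1.length →
          (IsBase c ∨ c.length ≤ u.1.length) ∧ c ≠ u := by
        rintro c (h | h)
        · exact ⟨.inl h, fun hc => hu.2 (hc ▸ h)⟩
        · exact ⟨.inr h.le, fun hc => h.ne (hc ▸ rfl)⟩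
      rcases hab with h | h
      · exact ⟨key a (.inl h.1), key b (.inl h.2)⟩
      · have ha := a.length_pos
        have hb := b.length_pos
        have h' : a.length + b.length ≤ u.1.length := h
        exact ⟨key a (.inr (by omega)), key b (.inr (by omega))⟩)
    p hu.1 (fun t ht => or_iff_not_imp_left.2 fun h => hmax t (Finset.mem_filter.2 ⟨ht, h⟩))
  have hker : gpIdealSpan k (ofNormal k (Option X) p) ≤ RingHom.ker φ.toAlgHom := by
    refine sInf_le ⟨fun a b hb => ?_, hφ⟩
    rw [RingHom.mem_ker] at hb ⊢
    exact (φ.map_bracket a b).trans (by rw [hb, map_zero])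
  ext g
  constructor
  · rintro ⟨hg, g, rfl⟩
    -- An element of GP(X) is a polynomial in base trees, none of which is `u`, so `φ` detects
    -- whether it vanishes.
    obtain ⟨q, hq, hqb⟩ := exists_ofNormal_eq (lift_mem_adjoin_normalValues (k := k)
      (P := IsBase (X := X)) (fun _ _ ha hb => ⟨ha, hb⟩) some (fun _ => rfl) g)
    have h0 := hker hg
    have hq0 : q = 0 := hinj q
      (fun t ht => ⟨.inl (hqb t ht), fun h => hu.2 (h ▸ hqb t ht)⟩) (by rw [hq]; exact h0)
    rw [hq0, map_zero] at hq
    exact hq.symm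
  · rintro rfl
    exact ⟨zero_mem _, zero_mem (baseSubalgebra k X)⟩

end FreeGP

theorem mainTheorem1 {k : Type*} [Field k] [CharZero k] {X : Type*}
    (f : FreeGP k (Option X)) (hf : f ∉ FreeGP.baseSubalgebra k X) :
    (gpIdealSpan k f : Set (FreeGP k (Option X))) ∩
      (FreeGP.baseSubalgebra k X : Set (FreeGP k (Option X))) = {0} :=
  FreeGP.gpIdealSpan_inter_baseSubalgebra f hf
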